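/- Let $(W,S)$ be a finite Coxeter system with length function $\ell$. For $I\subseteq S$ let $W_I$ be the subgroup generated by $I$, let $X_I=\{w\in W : \ell(ws)>\ell(w)\ \text{for all } s\in I\}$ be the set of minimal coset representatives of $W/W_I$, let $x_I=\sum_{w\in X_I}w\in\mathbb{Q}W$, and let $1_{W_I}^W$ be the character of $W$ induced from the trivial character of $W_I$. The elements $x_I$ ($I\subseteq S$) form a basis of the Solomon descent algebra $\Sigma W\subseteq\mathbb{Q}W$. Let $\Phi$ be the Solomon homomorphism, i.e. the $\mathbb{Q}$-linear map from $\Sigma W$ to the complex class functions on $W$ with $\Phi(x_I)=1_{W_I}^W$ for all $I\subseteq S$, and let $\Gamma W$ be the image of $\Phi$. Call $I,J\subseteq S$ equivalent if $wIw^{-1}=J$ for some $w\in W$; the equivalence classes are the Coxeter classes of $W$. A cuspidal class of $W_I$ is a conjugacy class of $W_I$ that is disjoint from $W_K$ for every $K\subsetneq I$. For a Coxeter class $\lambda$, the $\lambda$-set $C(\lambda)$ is the set of elements of Coxeter type $\lambda$: those $w\in W$ such that, for some $I\in\lambda$, the conjugacy class of $w$ in $W$ contains a cuspidal class of $W_I$.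 Then a class function $f:W\to\mathbb{C}$ belongs to $\Gamma W$ if and only if $f(w)\in\mathbb{Q}$ for all $w\in W$ and, for every Coxeter class $\lambda$, $f$ is constant on $C(\lambda)$. -/

import Mathlib

namespace CoxeterSystem

variable {B W : Type*} [Group W] {M : CoxeterMatrix B} (cs : CoxeterSystem M W)

/-- The standard parabolic subgroup `W_I`, generated by the simple reflections in `I`. -/
def parabolic (I : Set B) : Subgroup W := Subgroup.closure (cs.simple '' I)

/-- The set `X_I` of minimal coset representatives of `W / W_I`:
the `w` with `ℓ (w s) > ℓ w` for all `s ∈ I`. -/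
def minCosetReps (I : Set B) : Set W :=
  {w | ∀ i ∈ I, cs.length w < cs.length (w * cs.simple i)}

/-- The element `x_I = ∑_{w ∈ X_I} w` of the rational group algebra. -/
noncomputable def descentElement [Finite W] (I : Set B) : MonoidAlgebra ℚ W :=
  ∑ w ∈ (Set.toFinite (cs.minCosetReps I)).toFinset, MonoidAlgebra.single w 1

/-- The Solomon descent algebra `Σ W`, the linear span of the `x_I` in `ℚ W`
(only its vector space structure is used here). -/
noncomputable def descentAlgebra [Finite W] : Submodule ℚ (MonoidAlgebra ℚ W) :=
  Submodule.span ℚ (Set.range cs.descentElement)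

/-! ### Linear independence of the `x_I` -/

/-- The linear form `v ↦ 2 (α_i, v)` of the geometric representation. -/
noncomputable def geomForm (M : CoxeterMatrix B) (i : B) : Module.Dual ℝ (B →₀ ℝ) :=
  Finsupp.linearCombination ℝ fun j => -2 * Real.cos (Real.pi / M i j)

lemma geomForm_single (i j : B) :
    geomForm M i (Finsupp.single j 1) = -2 * Real.cos (Real.pi / M i j) := by
  simp [geomForm]

lemma geomForm_self (i : B) : geomForm M i (Finsupp.single i 1) = 2 := by
  simp [geomForm_single]

lemma geom_isLiftable :
    M.IsLiftable (fun i => Module.reflection (geomForm_self (M := M) i)) := by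
  intro i j
  by_cases hij : i = j
  · subst hij
    have h : Module.reflection (geomForm_self (M := M) i) *
        Module.reflection (geomForm_self (M := M) i) = 1 := by
      ext1 v
      simpa using Module.involutive_reflection (geomForm_self (M := M) i) v
    simp [h]
  have h1 : M i j ≠ 1 := M.off_diagonal i j hij
  rcases Nat.lt_or_ge (M i j) 3 with h3 | h3
  · have : M i j = 0 ∨ M i j = 2 := by omega
    rcases this with h | h
    · simp [h]
    · have hx : geomForm M i (Finsupp.single j 1) = 0 := by simp [geomForm_single, h]
      have hy : geomForm M j (Finsupp.single i 1) = 0 := by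
        simp [geomForm_single, M.symmetric j i, h]
      rw [h]
      ext1 v
      change _ = v
      simp only [pow_two, LinearEquiv.mul_apply, Module.reflection_apply, map_sub, map_smul, hx, hy,
        geomForm_self]
      module
  · set m := M i j with hm
    set θ : ℝ := 2 * Real.pi / m with hθ
    have hm0 : (0 : ℝ) < m := by exact_mod_cast (by omega : 0 < m)
    have hmθ : (m : ℝ) * θ = 2 * Real.pi := by rw [hθ]; field_simp
    have hsin : Real.sin θ ≠ 0 := by
      apply ne_of_gt
      apply Real.sin_pos_of_pos_of_lt_pi
      · rw [hθ]; positivity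
      · rw [hθ, div_lt_iff₀ hm0]
        have : (3 : ℝ) ≤ m := by exact_mod_cast h3
        nlinarith [Real.pi_pos]
    have ht : 2 * Real.cos θ = geomForm M i (Finsupp.single j 1) *
        geomForm M j (Finsupp.single i 1) - 2 := by
      rw [geomForm_single, geomForm_single, M.symmetric j i, ← hm]
      have : θ = 2 * (Real.pi / m) := by rw [hθ]; ring
      rw [this, Real.cos_two_mul]
      ring
    have hS (n : ℤ) := Polynomial.Chebyshev.S_two_mul_real_cos θ n
    ext1 v
    rw [Module.reflection_mul_reflection_pow_apply _ _ m v (2 * Real.cos θ) ht]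
    rcases Nat.even_or_odd' m with ⟨k, hk | hk⟩
    · have e1 : ((m : ℤ) - 2) / 2 = k - 1 := by omega
      have e2 : ((m : ℤ) - 1) / 2 = k - 1 := by omega
      have hz : (Polynomial.Chebyshev.S ℝ ((k : ℤ) - 1)).eval (2 * Real.cos θ) = 0 := by
        have h := hS ((k : ℤ) - 1)
        have hk' : (((k : ℤ) - 1 : ℤ) + 1 : ℝ) * θ = Real.pi := by
          have : (m : ℝ) = 2 * k := by exact_mod_cast hk
          rw [this] at hmθ
          push_cast
          linarith
        rw [hk', Real.sin_pi] at h
        exact (mul_eq_zero.mp h).resolve_right hsin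
      rw [e1, e2, hz]
      simp
    · have e1 : ((m : ℤ) - 2) / 2 = k - 1 := by omega
      have e2 : ((m : ℤ) - 1) / 2 = k := by omega
      have e3 : ((m : ℤ) - 3) / 2 = k - 1 := by omega
      have e4 : (m : ℤ) / 2 = k := by omega
      have hz : (Polynomial.Chebyshev.S ℝ (k : ℤ)).eval (2 * Real.cos θ) +
          (Polynomial.Chebyshev.S ℝ ((k : ℤ) - 1)).eval (2 * Real.cos θ) = 0 := by
        have h := hS (k : ℤ)
        have h' := hS ((k : ℤ) - 1)
        have hk' : (((k : ℤ) : ℝ) + 1) * θ = 2 * Real.pi - (((k : ℤ) - 1 : ℤ) + 1 : ℝ) * θ := by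
          have : (m : ℝ) = 2 * k + 1 := by exact_mod_cast hk
          rw [this] at hmθ
          push_cast
          linarith
        rw [hk', Real.sin_two_pi_sub, ← h'] at h
        have : ((Polynomial.Chebyshev.S ℝ (k : ℤ)).eval (2 * Real.cos θ) +
          (Polynomial.Chebyshev.S ℝ ((k : ℤ) - 1)).eval (2 * Real.cos θ)) * Real.sin θ = 0 := by
          linarith
        exact (mul_eq_zero.mp this).resolve_right hsin
      rw [e1, e2, e3, e4, hz]
      simp

lemma simple_mem_parabolic_iff (i : B) (K : Set B) :
    cs.simple i ∈ cs.parabolic K ↔ i ∈ K := by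
  constructor
  · intro h
    by_contra hi
    let ρ := cs.lift ⟨_, geom_isLiftable (M := M)⟩
    have key : ∀ w ∈ cs.parabolic K, ∀ v : B →₀ ℝ, (ρ w v) i = v i := by
      intro w hw
      refine Subgroup.closure_induction (p := fun w _ => ∀ v : B →₀ ℝ, (ρ w v) i = v i)
        ?_ ?_ ?_ ?_ hw
      · rintro _ ⟨j, hj, rfl⟩ v
        have : j ≠ i := fun h => hi (h ▸ hj)
        simp [ρ, Module.reflection_apply, this]
      · simp
      · intro x y _ _ hx hy v
        rw [map_mul, LinearEquiv.mul_apply, hx, hy]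
      · intro x _ hx v
        have := hx (ρ x⁻¹ v)
        rw [← LinearEquiv.mul_apply, ← map_mul] at this
        simpa using this.symm
    have h2 := key _ h (Finsupp.single i 1)
    simp [ρ] at h2
    norm_num at h2
  · intro h
    exact Subgroup.subset_closure ⟨i, h, rfl⟩

open Classical in
/-- The action of a simple reflection on pairs (element of `W`, parity). -/
noncomputable def parityMap (i : B) (p : W × ZMod 2) : W × ZMod 2 :=
  (cs.simple i * p.1 * cs.simple i, p.2 + if p.1 = cs.simple i then 1 else 0)

open Classical in
lemma parity_isLiftable :
    M.IsLiftable (fun i => (show Function.End (W × ZMod 2) from cs.parityMap i)) := by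
  intro i j
  set a := cs.simple i with ha
  set b := cs.simple j with hb
  set p := a * b with hp
  have ha2 : a * a = 1 := cs.simple_mul_simple_self i
  have hb2 : b * b = 1 := cs.simple_mul_simple_self j
  have hainv : a⁻¹ = a := cs.inv_simple i
  have hbinv : b⁻¹ = b := cs.inv_simple j
  have hpb : ∀ n : ℕ, p⁻¹ ^ n * b = b * p ^ n := by
    have h1 : SemiconjBy b p p⁻¹ := by
      simp only [SemiconjBy, hp, mul_inv_rev, hainv, hbinv, mul_assoc]
    intro n
    exact (h1.pow_right n).eq.symm
  let c : W → ℕ → ZMod 2 := fun t l => if t = b * p ^ l then 1 else 0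
  have step : ∀ (n : ℕ) (t : W) (e : ZMod 2),
      ((show Function.End (W × ZMod 2) from cs.parityMap i) *
        (show Function.End (W × ZMod 2) from cs.parityMap j)) ^ n • (t, e) =
      (p ^ n * t * p⁻¹ ^ n, e + ∑ l ∈ Finset.range (2 * n), c t l) := by
    intro n
    induction n with
    | zero => intro t e; simp
    | succ n ih =>
      intro t e
      rw [pow_succ', mul_smul, ih, mul_smul]
      change cs.parityMap i (cs.parityMap j _) = _
      have h1 : (p ^ n * t * p⁻¹ ^ n = b) ↔ t = b * p ^ (2 * n) := by
        rw [two_mul, pow_add, ← mul_assoc, ← hpb, inv_pow, mul_inv_eq_iff_eq_mul, mul_assoc,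
          eq_inv_mul_iff_mul_eq]
      have h2 : (b * (p ^ n * t * p⁻¹ ^ n) * b = a) ↔ t = b * p ^ (2 * n + 1) := by
        have e1 : b * p ^ (2 * n + 1) = p⁻¹ ^ n * (b * p) * p ^ n := by
          rw [← mul_assoc, hpb]
          group
        rw [e1, inv_pow, mul_assoc _ _ (p ^ n), eq_inv_mul_iff_mul_eq, ← mul_inv_eq_iff_eq_mul]
        have e2 : b * p = b * a * b := by rw [hp, mul_assoc]
        rw [e2]
        constructor
        · intro h
          rw [← h]
          simp [mul_assoc, hb2, ← mul_assoc b b]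
        · intro h
          rw [h]
          simp [mul_assoc, hb2, ← mul_assoc b b]
      simp only [parityMap, ← ha, ← hb, h1, h2]
      ext1
      · have e3 : p⁻¹ = b * a := by rw [hp, mul_inv_rev, hainv, hbinv]
        have e4 : ∀ x : W, a * (b * x * b) * a = p * x * p⁻¹ := by
          intro x
          rw [e3, hp]
          simp only [mul_assoc]
        change a * (b * (p ^ n * t * p⁻¹ ^ n) * b) * a = p ^ (n + 1) * t * p⁻¹ ^ (n + 1)
        rw [e4, pow_succ' p, pow_succ p⁻¹]
        simp only [mul_assoc]
      · rw [mul_add, Finset.sum_range_succ, Finset.sum_range_succ]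
        simp [c, add_assoc]
  funext ⟨t, e⟩
  have h := step (M i j) t e
  have hpm : p ^ M i j = 1 := cs.simple_mul_simple_pow i j
  refine h.trans ?_
  have hsum : ∑ l ∈ Finset.range (2 * M i j), c t l = 0 := by
    rw [two_mul, Finset.sum_range_add]
    have : ∀ l, c t (M i j + l) = c t l := by
      intro l
      simp [c, pow_add, hpm]
    simp only [this]
    exact CharTwo.add_self_eq_zero _
  simp only [hsum, inv_pow, hpm, one_mul, inv_one, mul_one, add_zero]
  rfl

open Classical in
lemma parity_wordProd (ω : List B) (t : W) (e : ZMod 2) :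
    cs.lift ⟨_, cs.parity_isLiftable⟩ (cs.wordProd ω) • (t, e) =
      (cs.wordProd ω * t * (cs.wordProd ω)⁻¹, e + ((cs.rightInvSeq ω).count t : ZMod 2)) := by
  induction ω with
  | nil => simp
  | cons i ω ih =>
    rw [wordProd_cons, map_mul, mul_smul, ih, lift_apply_simple]
    change cs.parityMap i _ = _
    have h : (cs.wordProd ω * t * (cs.wordProd ω)⁻¹ = cs.simple i) ↔
        (cs.wordProd ω)⁻¹ * cs.simple i * cs.wordProd ω = t := by
      rw [mul_inv_eq_iff_eq_mul, mul_assoc, inv_mul_eq_iff_eq_mul, eq_comm]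
    ext1
    · simp [parityMap, mul_assoc]
    · simp [parityMap, rightInvSeq, List.count_cons, h, add_assoc]

lemma exists_word_of_mem_parabolic {K : Set B} {w : W} (hw : w ∈ cs.parabolic K) :
    ∃ ω : List B, (∀ t ∈ cs.rightInvSeq ω, t ∈ cs.parabolic K) ∧ cs.wordProd ω = w := by
  suffices ∃ ω : List B, (∀ i ∈ ω, i ∈ K) ∧ cs.wordProd ω = w by
    obtain ⟨ω, hω, rfl⟩ := this
    refine ⟨ω, ?_, rfl⟩
    clear hw
    have hprod : ∀ ω : List B, (∀ i ∈ ω, i ∈ K) → cs.wordProd ω ∈ cs.parabolic K := by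
      intro ω hω
      apply Subgroup.list_prod_mem
      intro x hx
      obtain ⟨i, hi, rfl⟩ := List.mem_map.mp hx
      exact Subgroup.subset_closure ⟨i, hω i hi, rfl⟩
    induction ω with
    | nil => simp
    | cons i ω ih =>
      have h1 : ∀ j ∈ ω, j ∈ K := fun j hj => hω j (List.mem_cons_of_mem _ hj)
      intro t ht
      rcases List.mem_cons.mp ht with rfl | ht
      · exact mul_mem (mul_mem (inv_mem (hprod ω h1))
          (Subgroup.subset_closure ⟨i, hω i List.mem_cons_self, rfl⟩)) (hprod ω h1)
      · exact ih h1 t ht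
  refine Subgroup.closure_induction
    (p := fun w _ => ∃ ω : List B, (∀ i ∈ ω, i ∈ K) ∧ cs.wordProd ω = w) ?_ ?_ ?_ ?_ hw
  · rintro _ ⟨i, hi, rfl⟩
    exact ⟨[i], by simpa using hi, by simp⟩
  · exact ⟨[], by simp, by simp⟩
  · rintro _ _ _ _ ⟨ω, h, rfl⟩ ⟨ω', h', rfl⟩
    refine ⟨ω ++ ω', ?_, cs.wordProd_append _ _⟩
    intro i hi
    rcases List.mem_append.mp hi with hi | hi
    exacts [h i hi, h' i hi]
  · rintro _ _ ⟨ω, h, rfl⟩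
    exact ⟨ω.reverse, by simpa using h, cs.wordProd_reverse _⟩

lemma length_lt_of_mem_parabolic {K : Set B} {w : W} (hw : w ∈ cs.parabolic K) {i : B}
    (hi : i ∉ K) : cs.length w < cs.length (w * cs.simple i) := by
  classical
  obtain ⟨ω, hω, rfl⟩ := cs.exists_word_of_mem_parabolic hw
  obtain ⟨ω', hω', hprod⟩ := cs.exists_isReduced (cs.wordProd ω * cs.simple i)
  have hc : (cs.rightInvSeq ω).count (cs.simple i) = 0 := by
    rw [List.count_eq_zero]
    intro h
    exact hi ((cs.simple_mem_parabolic_iff i K).mp (hω _ h))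
  have h1 := cs.parity_wordProd ω' (cs.simple i) 0
  have h2 := cs.parity_wordProd ω (cs.simple i) 1
  rw [← hprod, map_mul, mul_smul, lift_apply_simple] at h1
  have h3 : (show Function.End (W × ZMod 2) from cs.parityMap i) • (cs.simple i, (0 : ZMod 2)) =
      (cs.simple i, 1) := by
    change cs.parityMap i _ = _
    simp [parityMap]
  rw [h3, h2, hc] at h1
  have h4 := congrArg Prod.snd h1
  have hmem : cs.simple i ∈ cs.rightInvSeq ω' := by
    by_contra hn
    rw [List.count_eq_zero_of_not_mem hn] at h4
    simp at h4
  have h5 := (cs.isRightInversion_of_mem_rightInvSeq hω' hmem).2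
  rw [← hprod] at h5
  simpa using h5

lemma exists_minCosetReps_iff [Finite W] (K : Set B) :
    ∃ w : W, ∀ I : Set B, w ∈ cs.minCosetReps I ↔ I ⊆ K := by
  obtain ⟨w, hw, hmax⟩ := Set.exists_max_image (cs.parabolic Kᶜ : Set W) cs.length
    (Set.toFinite _) ⟨1, one_mem _⟩
  refine ⟨w, fun I => ⟨fun h i hi => ?_, fun h i hi => ?_⟩⟩
  · by_contra hn
    exact absurd (h i hi) (not_lt.mpr (hmax _
      (mul_mem hw (Subgroup.subset_closure ⟨i, hn, rfl⟩))))
  · exact cs.length_lt_of_mem_parabolic hw (fun hn => hn (h hi))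

lemma simple_injective : Function.Injective cs.simple := by
  intro i j h
  have : cs.simple i ∈ cs.parabolic {j} := h ▸ Subgroup.subset_closure ⟨j, rfl, rfl⟩
  exact (cs.simple_mem_parabolic_iff i {j}).mp this

theorem linearIndependent_descentElement [Finite W] :
    LinearIndependent ℚ cs.descentElement := by
  classical
  have : Finite B := Finite.of_injective _ cs.simple_injective
  rw [linearIndependent_iff']
  intro s g hg I
  induction I using (wellFounded_lt (α := Set B)).induction with
  | _ I ih =>
    intro hI
    obtain ⟨w, hw⟩ := cs.exists_minCosetReps_iff I
    have h := congrArg (fun x : MonoidAlgebra ℚ W => x.coeff w) hg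
    have hcoeff : ∀ J, (cs.descentElement J).coeff w = if J ⊆ I then 1 else 0 := by
      intro J
      simp [descentElement, MonoidAlgebra.coeff_sum, Finsupp.finsetSum_apply,
        Finsupp.single_apply, hw]
    simp only [MonoidAlgebra.coeff_sum, Finsupp.finsetSum_apply, MonoidAlgebra.coeff_smul,
      Finsupp.smul_apply, hcoeff] at h
    rw [Finset.sum_eq_single I] at h
    · simpa using h
    · intro J hJ hne
      by_cases hJI : J ⊆ I
      · rw [ih J (lt_of_le_of_ne hJI hne) hJ]; simp
      · simp [hJI]
    · exact fun h => absurd hI h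

/-! ### Class functions and the Solomon homomorphism -/

/-- The algebra of complex-valued class functions on a group. -/
def classFunctions (W : Type*) [Group W] : Subalgebra ℂ (W → ℂ) where
  carrier := {f | ∀ g h : W, f (h * g * h⁻¹) = f g}
  mul_mem' hf hf' g h := by simp [hf g h, hf' g h]
  add_mem' hf hf' g h := by simp [hf g h, hf' g h]
  algebraMap_mem' _ _ _ := rfl

/-- The character of `W` induced from the trivial character of `W_I`. -/
noncomputable def inducedTrivial (I : Set B) : classFunctions W :=
  ⟨((Representation.trivial ℂ (cs.parabolic I) ℂ).ind (cs.parabolic I).subtype).character,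
    fun g h => Representation.char_conj _ g h⟩

/-- The Solomon homomorphism `Φ`: the linear map on `Σ W` that sends the basis element `x_I`
to the character of `W` induced from the trivial character of `W_I`. -/
noncomputable def solomonHom [Finite W] : cs.descentAlgebra →ₗ[ℚ] classFunctions W :=
  (Module.Basis.span cs.linearIndependent_descentElement).constr ℚ cs.inducedTrivial

lemma solomonHom_descentElement [Finite W] (I : Set B) :
    cs.solomonHom ⟨cs.descentElement I, Submodule.subset_span ⟨I, rfl⟩⟩ =
      cs.inducedTrivial I := by
  have h := (Module.Basis.span cs.linearIndependent_descentElement).constr_basis ℚ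
    cs.inducedTrivial I
  rw [Module.Basis.span_apply] at h
  exact h

/-- `Γ W`, the image of the Solomon homomorphism. -/
noncomputable def solomonImage [Finite W] : Submodule ℚ (classFunctions W) :=
  LinearMap.range cs.solomonHom

/-! ### Coxeter classes and `λ`-sets -/

/-- `W`-conjugacy of subsets of the set of simple reflections: `w I w⁻¹ = J` for some `w`. -/
def conjSetoid : Setoid (Set B) where
  r I J := ∃ w : W, (fun x => w * x * w⁻¹) '' (cs.simple '' I) = cs.simple '' J
  iseqv :=
    { refl := fun I => ⟨1, by simp⟩
      symm := by
        rintro I J ⟨w, h⟩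
        refine ⟨w⁻¹, ?_⟩
        rw [← h, Set.image_image]
        simp [mul_assoc]
      trans := by
        rintro I J K ⟨w, h⟩ ⟨v, h'⟩
        refine ⟨v * w, ?_⟩
        rw [← h', ← h]
        simp only [Set.image_image]
        simp [mul_assoc] }

/-- The set `Λ(W)` of Coxeter classes. -/
def CoxeterClass : Type _ := Quotient cs.conjSetoid

/-- `C` is an `I`-cuspidal class: a conjugacy class of the group `W_I` that is disjoint from `W_K`
for every proper subset `K` of `I`. -/
def IsCuspidalClass (I : Set B) (C : Set W) : Prop :=
  (∃ u ∈ cs.parabolic I, C = {x | ∃ g ∈ cs.parabolic I, x = g * u * g⁻¹}) ∧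
    ∀ K : Set B, K ⊂ I → Disjoint C (cs.parabolic K : Set W)

/-- `w` is an `I`-element: its conjugacy class in `W` contains an `I`-cuspidal class, that is, `w` is
conjugate to an element of `W_I` which is not `W_I`-conjugate into `W_K` for any proper subset `K`
of `I`. -/
def IsElementOfType (I : Set B) (w : W) : Prop :=
  ∃ C : Set W, cs.IsCuspidalClass I C ∧ C ⊆ {x | IsConj w x}

/-- The `λ`-set `C(λ)`: the elements of `W` that are `I`-elements for some `I` in the Coxeter
class `λ`. -/
def coxeterTypeSet (l : cs.CoxeterClass) : Set W :=
  {w | ∃ I : Set B, Quotient.mk cs.conjSetoid I = l ∧ cs.IsElementOfType I w}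

end CoxeterSystem

/-! `Γ W` is the rational span of the characters induced from the trivial characters of the `W_J`,
and such a character counts the cosets `x W_J` fixed by an element. The theorem says that the table
of these counts against types is well defined and triangular.

Let `u` be cuspidal in `W_I` and fix `x W_J`. Write `x = a d b` with `a ∈ W_I`, `b ∈ W_J` and `d`
minimal in `W_I d` and in `d W_J`. By `mem_parabolic_inter`, `a⁻¹ u a` lies in the parabolic
subgroup of those `i ∈ I` for which `d⁻¹ s_i d` is a simple reflection from `J`. Cuspidality makes
this all of `I` (`IsCuspidal.exists_of_conj_mem`), so all of `W_I` fixes `x W_J`. Hence the count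
depends only on the Coxeter class of `I`. It vanishes unless `I` is conjugate to a subset of `J`,
and is nonzero if `I` is conjugate to `J`.

Conversely, a rational function constant on the `λ`-sets is cleared rank by rank, from the largest
rank down, by subtracting rational multiples of induced characters
(`mem_solomonImage_of_vanishing`). -/

namespace CoxeterSystem

variable {B W : Type*} [Group W] {M : CoxeterMatrix B} (cs : CoxeterSystem M W)

/-! ### The parity cocycle -/

/-- The parity of the number of occurrences of `t` in the right inversion sequence of any word
for `w`. -/
noncomputable def invParity (w t : W) : ZMod 2 :=
  (cs.lift ⟨_, cs.parity_isLiftable⟩ w • (t, (0 : ZMod 2))).2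

open Classical in
lemma invParity_wordProd (ω : List B) (t : W) :
    cs.invParity (cs.wordProd ω) t = ((cs.rightInvSeq ω).count t : ZMod 2) := by
  rw [invParity, parity_wordProd]
  simp

lemma lift_parity_smul (w t : W) (e : ZMod 2) :
    cs.lift ⟨_, cs.parity_isLiftable⟩ w • (t, e) = (w * t * w⁻¹, e + cs.invParity w t) := by
  obtain ⟨ω, rfl⟩ := cs.wordProd_surjective w
  rw [parity_wordProd, invParity_wordProd]

/-- Cocycle identity of the action on pairs: `v` moves `t` to `v t v⁻¹`, and parities add. -/
lemma invParity_mul (u v t : W) :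
    cs.invParity (u * v) t = cs.invParity v t + cs.invParity u (v * t * v⁻¹) := by
  conv_lhs => rw [invParity, map_mul, mul_smul, lift_parity_smul, lift_parity_smul]
  simp

lemma invParity_simple_self (i : B) : cs.invParity (cs.simple i) (cs.simple i) = 1 := by
  have h := cs.invParity_wordProd [i] (cs.simple i)
  simpa using h

lemma length_mul_lt_of_invParity_ne_zero {w t : W} (h : cs.invParity w t ≠ 0) :
    cs.length (w * t) < cs.length w := by
  classical
  obtain ⟨ω, hω, rfl⟩ := cs.exists_isReduced w
  refine (cs.isRightInversion_of_mem_rightInvSeq hω (t := t) ?_).2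
  by_contra hn
  exact h (by rw [invParity_wordProd, List.count_eq_zero_of_not_mem hn, Nat.cast_zero])

/-- Were the parity 0, the cocycle identity would give `w s_i` parity 1 at `s_i`, so `w = (w s_i)
s_i` would be shorter than `w s_i`. -/
lemma invParity_simple_of_length_lt {w : W} {i : B}
    (h : cs.length (w * cs.simple i) < cs.length w) : cs.invParity w (cs.simple i) = 1 := by
  by_contra hn
  have h0 : cs.invParity w (cs.simple i) = 0 := by
    revert hn
    generalize cs.invParity w (cs.simple i) = a
    revert a
    decide
  have h1 : cs.invParity (w * cs.simple i) (cs.simple i) ≠ 0 := by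
    rw [invParity_mul, invParity_simple_self]
    simp [h0]
  have := cs.length_mul_lt_of_invParity_ne_zero h1
  rw [cs.simple_mul_simple_cancel_right] at this
  omega

lemma mem_parabolic_of_invParity_ne_zero {K : Set B} {w t : W} (hw : w ∈ cs.parabolic K)
    (h : cs.invParity w t ≠ 0) : t ∈ cs.parabolic K := by
  classical
  obtain ⟨ω, hω, rfl⟩ := cs.exists_word_of_mem_parabolic hw
  refine hω t ?_
  by_contra hn
  exact h (by rw [invParity_wordProd, List.count_eq_zero_of_not_mem hn, Nat.cast_zero])

/-! ### Minimal coset representatives and intersections of parabolic subgroups -/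

lemma exists_rightDescent_of_mem_parabolic {K : Set B} {v : W} (hv : v ∈ cs.parabolic K)
    (h1 : v ≠ 1) : ∃ j ∈ K, cs.length (v * cs.simple j) < cs.length v := by
  obtain ⟨j, hj⟩ := cs.exists_rightDescent_of_ne_one h1
  refine ⟨j, ?_, hj⟩
  by_contra hn
  exact absurd (cs.length_lt_of_mem_parabolic hv hn) (not_lt.mpr hj.le)

lemma simple_mem_parabolic {K : Set B} {i : B} (hi : i ∈ K) : cs.simple i ∈ cs.parabolic K :=
  Subgroup.subset_closure ⟨i, hi, rfl⟩

lemma invParity_eq_zero_of_minimal {J : Set B} {d : W}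
    (hd : ∀ v ∈ cs.parabolic J, cs.length d ≤ cs.length (d * v)) {t : W}
    (ht : t ∈ cs.parabolic J) : cs.invParity d t = 0 := by
  by_contra hn
  exact absurd (cs.length_mul_lt_of_invParity_ne_zero hn) (not_lt.mpr (hd t ht))

/-- Induction on the length of `v`: `d` has parity 0 on all of `W_J`, so by the cocycle identity a
right descent of `v` is also one of `d v`. -/
lemma length_mul_of_minimal {J : Set B} {d : W}
    (hd : ∀ v ∈ cs.parabolic J, cs.length d ≤ cs.length (d * v)) {v : W}
    (hv : v ∈ cs.parabolic J) : cs.length (d * v) = cs.length d + cs.length v := by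
  induction hn : cs.length v using Nat.strong_induction_on generalizing v with
  | _ n ih =>
    by_cases h1 : v = 1
    · subst h1
      simp at hn
      simp [← hn]
    obtain ⟨j, hj, hlt⟩ := cs.exists_rightDescent_of_mem_parabolic hv h1
    have hjm := cs.simple_mem_parabolic hj
    have hv' := mul_mem hv hjm
    have h2 := ih _ (hn ▸ hlt) hv' rfl
    have h3 : cs.length (d * (v * cs.simple j)) < cs.length (d * v) := by
      rw [← mul_assoc]
      apply cs.length_mul_lt_of_invParity_ne_zero
      rw [invParity_mul, cs.invParity_simple_of_length_lt hlt,
        cs.invParity_eq_zero_of_minimal hd (mul_mem hv' (inv_mem hv))]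
      simp
    have h4 := cs.length_mul_le d v
    have h5 := cs.length_mul_simple v j
    omega

lemma length_mul_of_minimal_left {I : Set B} {d : W}
    (hd : ∀ v ∈ cs.parabolic I, cs.length d ≤ cs.length (v * d)) {v : W}
    (hv : v ∈ cs.parabolic I) : cs.length (v * d) = cs.length v + cs.length d := by
  have h := cs.length_mul_of_minimal (J := I) (d := d⁻¹) (v := v⁻¹) (fun v hv => by
    have := hd _ (inv_mem hv)
    rw [← cs.length_inv (v⁻¹ * d)] at this
    simpa using this) (inv_mem hv)
  rw [← mul_inv_rev] at h
  simp only [length_inv] at h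
  omega

/-- The part of Kilmoyer's theorem on intersections of parabolic subgroups that bounds
`W_I ∩ d W_J d⁻¹` from above, for `d` of minimal length in `W_I d` and in `d W_J`. -/
lemma mem_parabolic_inter {I J : Set B} {d : W}
    (hdI : ∀ v ∈ cs.parabolic I, cs.length d ≤ cs.length (v * d))
    (hdJ : ∀ v ∈ cs.parabolic J, cs.length d ≤ cs.length (d * v)) {w v : W}
    (hw : w ∈ cs.parabolic I) (hv : v ∈ cs.parabolic J) (h : w * d = d * v) :
    w ∈ cs.parabolic {i | i ∈ I ∧ ∃ j ∈ J, cs.simple i * d = d * cs.simple j} := by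
  induction hn : cs.length v using Nat.strong_induction_on generalizing v w with
  | _ n ih =>
    by_cases h1 : v = 1
    · subst h1
      have : w = 1 := by simpa using h
      rw [this]
      exact one_mem _
    obtain ⟨j, hj, hlt⟩ := cs.exists_rightDescent_of_mem_parabolic hv h1
    have hjm := cs.simple_mem_parabolic hj
    -- The parity of `w d = d v` at `s_j` is computed from both factorizations; only the terms of
    -- `v` and `w` survive.
    have hpar : cs.invParity w (d * cs.simple j * d⁻¹) ≠ 0 := by
      have e1 := cs.invParity_mul w d (cs.simple j)
      rw [h, cs.invParity_mul, cs.invParity_simple_of_length_lt hlt,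
        cs.invParity_eq_zero_of_minimal hdJ (mul_mem (mul_mem hv hjm) (inv_mem hv)),
        cs.invParity_eq_zero_of_minimal hdJ hjm, zero_add, add_zero] at e1
      simp [← e1]
    have ht := cs.mem_parabolic_of_invParity_ne_zero hw hpar
    -- With `t = d s_j d⁻¹ ∈ W_I`, additivity of length on both sides of `t d = d s_j` forces `t` to
    -- have length 1.
    have hlen := cs.length_mul_of_minimal_left hdI ht
    rw [inv_mul_cancel_right, cs.length_mul_of_minimal hdJ hjm, cs.length_simple] at hlen
    obtain ⟨i, hi⟩ := cs.length_eq_one_iff.mp (by omega :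
      cs.length (d * cs.simple j * d⁻¹) = 1)
    have hiI : i ∈ I := (cs.simple_mem_parabolic_iff i I).mp (hi ▸ ht)
    have hid : cs.simple i * d = d * cs.simple j := by rw [← hi, inv_mul_cancel_right]
    have h2 := ih _ (hn ▸ hlt) (mul_mem hw (cs.simple_mem_parabolic hiI)) (mul_mem hv hjm)
      (by rw [mul_assoc, hid, ← mul_assoc, h, mul_assoc]) rfl
    have h3 := mul_mem h2 (cs.simple_mem_parabolic
      (K := {i | i ∈ I ∧ ∃ j ∈ J, cs.simple i * d = d * cs.simple j}) ⟨hiI, j, hj, hid⟩)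
    rwa [cs.simple_mul_simple_cancel_right] at h3

/-- A shortest element of the double coset `W_I x W_J` is minimal in both one-sided cosets. -/
lemma exists_minimal_double_coset (I J : Set B) (x : W) :
    ∃ a ∈ cs.parabolic I, ∃ b ∈ cs.parabolic J, ∃ d : W, x = a * d * b ∧
      (∀ v ∈ cs.parabolic I, cs.length d ≤ cs.length (v * d)) ∧
      ∀ v ∈ cs.parabolic J, cs.length d ≤ cs.length (d * v) := by
  let S : Set W := {d | ∃ a ∈ cs.parabolic I, ∃ b ∈ cs.parabolic J, x = a * d * b}
  have hS : S.Nonempty := ⟨x, 1, one_mem _, 1, one_mem _, by simp⟩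
  obtain ⟨a, ha, b, hb, hx⟩ := Function.argminOn_mem cs.length S hS
  refine ⟨a, ha, b, hb, _, hx, fun v hv => ?_, fun v hv => ?_⟩
  · exact Function.argminOn_le cs.length S
      ⟨a * v⁻¹, mul_mem ha (inv_mem hv), b, hb, by simpa [mul_assoc] using hx⟩
  · exact Function.argminOn_le cs.length S
      ⟨a, ha, v⁻¹ * b, mul_mem (inv_mem hv) hb, by simpa [mul_assoc] using hx⟩

/-! ### Cuspidal elements -/

/-- `u` lies in `W_I` and is not `W_I`-conjugate into `W_K` for any proper subset `K` of `I`. -/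
def IsCuspidal (I : Set B) (u : W) : Prop :=
  u ∈ cs.parabolic I ∧
    ∀ K ⊂ I, ∀ g ∈ cs.parabolic I, g * u * g⁻¹ ∉ cs.parabolic K

lemma IsElementOfType.exists_isCuspidal {cs : CoxeterSystem M W} {I : Set B} {w : W}
    (h : cs.IsElementOfType I w) : ∃ u, cs.IsCuspidal I u ∧ IsConj w u := by
  obtain ⟨C, ⟨⟨u, hu, rfl⟩, hK⟩, hC⟩ := h
  refine ⟨u, ⟨hu, fun K hKI g hg hmem => ?_⟩, hC ⟨1, one_mem _, by simp⟩⟩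
  exact Set.disjoint_left.mp (hK K hKI) ⟨g, hg, rfl⟩ hmem

lemma IsCuspidal.isElementOfType {cs : CoxeterSystem M W} {I : Set B} {u w : W}
    (hu : cs.IsCuspidal I u) (h : IsConj w u) : cs.IsElementOfType I w := by
  refine ⟨_, ⟨⟨u, hu.1, rfl⟩, fun K hK => Set.disjoint_left.mpr ?_⟩, ?_⟩
  · rintro _ ⟨g, hg, rfl⟩
    exact hu.2 K hK g hg
  · rintro _ ⟨g, -, rfl⟩
    exact h.trans (isConj_iff.mpr ⟨g, rfl⟩)

lemma IsCuspidal.exists_of_conj_mem {cs : CoxeterSystem M W} {I J : Set B} {u x : W}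
    (hu : cs.IsCuspidal I u) (hx : x⁻¹ * u * x ∈ cs.parabolic J) :
    (∀ v ∈ cs.parabolic I, x⁻¹ * v * x ∈ cs.parabolic J) ∧
      ∃ d : W, ∀ i ∈ I, ∃ j ∈ J, cs.simple i * d = d * cs.simple j := by
  obtain ⟨a, ha, b, hb, d, rfl, hdI, hdJ⟩ := cs.exists_minimal_double_coset I J x
  have hv : d⁻¹ * (a⁻¹ * u * a) * d ∈ cs.parabolic J := by
    have := mul_mem (mul_mem hb hx) (inv_mem hb)
    simpa [mul_assoc] using this
  have hmem := cs.mem_parabolic_inter hdI hdJ (mul_mem (mul_mem (inv_mem ha) hu.1) ha) hv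
    (by simp [mul_assoc])
  have hK : {i | i ∈ I ∧ ∃ j ∈ J, cs.simple i * d = d * cs.simple j} = I := by
    by_contra hne
    refine hu.2 _ (lt_of_le_of_ne (fun i hi => hi.1) hne) a⁻¹ (inv_mem ha) ?_
    simpa using hmem
  have hd : ∀ i ∈ I, ∃ j ∈ J, cs.simple i * d = d * cs.simple j := fun i hi => by
    rw [← hK] at hi
    exact hi.2
  refine ⟨?_, d, hd⟩
  have hle : cs.parabolic I ≤ (cs.parabolic J).comap (MulAut.conj d⁻¹).toMonoidHom := by
    refine (Subgroup.closure_le _).mpr ?_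
    rintro _ ⟨i, hi, rfl⟩
    obtain ⟨j, hj, hij⟩ := hd i hi
    simp [mul_assoc, hij, cs.simple_mem_parabolic hj]
  intro v hv
  have := hle (mul_mem (mul_mem (inv_mem ha) hv) ha)
  simp only [Subgroup.mem_comap, MulEquiv.coe_toMonoidHom, MulAut.conj_apply, inv_inv] at this
  have := mul_mem (mul_mem (inv_mem hb) this) hb
  simpa [mul_assoc] using this

/-- Take `I` minimal among the subsets whose parabolic subgroup meets the conjugacy class of `w`. -/
lemma exists_isElementOfType [Finite W] (w : W) : ∃ I, cs.IsElementOfType I w := by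
  have : Finite B := Finite.of_injective _ cs.simple_injective
  let S : Set (Set B) := {I | ∃ g : W, g * w * g⁻¹ ∈ cs.parabolic I}
  have hS : S.Nonempty := by
    refine ⟨Set.univ, 1, ?_⟩
    rw [parabolic, Set.image_univ, subgroup_closure_range_simple]
    trivial
  obtain ⟨I, hI⟩ := exists_minimal_of_wellFoundedLT (· ∈ S) hS
  obtain ⟨g, hg⟩ := hI.prop
  refine ⟨I, IsCuspidal.isElementOfType ⟨hg, fun K hK h _ hmem => ?_⟩ (isConj_iff.mpr ⟨g, rfl⟩)⟩
  refine hI.not_prop_of_lt hK ⟨h * g, ?_⟩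
  simpa [mul_assoc] using hmem

end CoxeterSystem

/-! ### Induction of the trivial character as a permutation character -/

namespace Representation

variable (k : Type*) {G : Type*} [CommRing k] [Group G] (H : Subgroup G)

lemma IndV.mk_trivial_mul (h : H) (g : G) (a : k) :
    IndV.mk H.subtype (trivial k H k) (h * g) a = IndV.mk H.subtype (trivial k H k) g a := by
  have := Coinvariants.mk_self_apply
    (tprod ((leftRegular k G).comp H.subtype) (trivial k H k)) h
    (MonoidAlgebra.single g 1 ⊗ₜ a)
  simpa [ofMulAction_single] using this

/-- The representation induced from the trivial representation of a subgroup is the permutation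
representation on the cosets. -/
noncomputable def indTrivialEquiv :
    IndV H.subtype (trivial k H k) ≃ₗ[k] (G ⧸ H →₀ k) :=
  LinearEquiv.ofLinearMap
    (Coinvariants.lift _
      (TensorProduct.lift ((Finsupp.lift _ k G fun g =>
        -- The class of `g` in the coinvariants depends only on `H g`; inversion turns this into a
        -- left coset.
        (Finsupp.lsingle (QuotientGroup.mk g⁻¹ : G ⧸ H) : k →ₗ[k] (G ⧸ H →₀ k))) ∘ₗ
          (MonoidAlgebra.coeffLinearEquiv k).toLinearMap))
      (fun h => by
        ext g : 4
        simp [ofMulAction_single]))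
    (Finsupp.linearCombination k fun c : G ⧸ H =>
      Quotient.liftOn' c (fun g => IndV.mk H.subtype (trivial k H k) g⁻¹ 1) (by
        intro a b hab
        rw [QuotientGroup.leftRel_apply] at hab
        have := IndV.mk_trivial_mul k H ⟨_, hab⟩ b⁻¹ 1
        simpa using this))
    (by
      ext c : 2
      induction c using QuotientGroup.induction_on with
      | H g => simp)
    (by
      ext g
      simp)

lemma indTrivialEquiv_symm_single (g : G) :
    (indTrivialEquiv k H).symm (Finsupp.single (g : G ⧸ H) 1) =
      IndV.mk H.subtype (trivial k H k) g⁻¹ 1 := by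
  simp [indTrivialEquiv]

lemma ind_trivial_indTrivialEquiv_symm_single (w : G) (c : G ⧸ H) :
    ind H.subtype (trivial k H k) w ((indTrivialEquiv k H).symm (Finsupp.single c 1)) =
      (indTrivialEquiv k H).symm (Finsupp.single (w • c) 1) := by
  induction c using QuotientGroup.induction_on with
  | H g =>
    rw [MulAction.Quotient.smul_coe, indTrivialEquiv_symm_single, indTrivialEquiv_symm_single,
      ind_mk]
    simp

/-- The character induced from the trivial character of a subgroup counts fixed cosets. -/
theorem character_ind_trivial {k : Type*} [Field k] [Finite G] (w : G) :
    (ind H.subtype (trivial k H k)).character w = Nat.card {c : G ⧸ H // w • c = c} := by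
  classical
  have := Fintype.ofFinite (G ⧸ H)
  -- In the basis of cosets `w` acts by a permutation matrix, whose trace counts fixed points.
  rw [character, LinearMap.trace_eq_matrix_trace k (Module.Basis.ofRepr (indTrivialEquiv k H)),
    Matrix.trace, Nat.card_eq_fintype_card, Fintype.card_subtype, Finset.card_filter]
  push_cast
  refine Finset.sum_congr rfl fun c _ => ?_
  rw [Matrix.diag_apply, LinearMap.toMatrix_apply, Module.Basis.coe_ofRepr,
    ind_trivial_indTrivialEquiv_symm_single]
  simp [Finsupp.single_apply]

end Representation

namespace CoxeterSystem

variable {B W : Type*} [Group W] {M : CoxeterMatrix B} (cs : CoxeterSystem M W)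

/-! ### Values of the induced characters -/

lemma classFunctions_eq_of_isConj (f : classFunctions W) {u v : W} (h : IsConj u v) :
    (f : W → ℂ) u = (f : W → ℂ) v := by
  obtain ⟨g, rfl⟩ := isConj_iff.mp h
  exact (f.2 u g).symm

lemma inducedTrivial_apply [Finite W] (J : Set B) (w : W) :
    (cs.inducedTrivial J : W → ℂ) w = Nat.card {c : W ⧸ cs.parabolic J // w • c = c} :=
  Representation.character_ind_trivial (cs.parabolic J) w

lemma smul_mk_eq_iff {G : Type*} [Group G] {H : Subgroup G} (w x : G) :
    w • (x : G ⧸ H) = x ↔ x⁻¹ * w * x ∈ H := by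
  rw [MulAction.Quotient.smul_coe, eq_comm, QuotientGroup.eq, smul_eq_mul, mul_assoc]

lemma IsCuspidal.smul_eq_iff {cs : CoxeterSystem M W} {I J : Set B} {u : W}
    (hu : cs.IsCuspidal I u) (c : W ⧸ cs.parabolic J) :
    u • c = c ↔ ∀ v ∈ cs.parabolic I, v • c = c := by
  refine ⟨fun h v hv => ?_, fun h => h u hu.1⟩
  induction c using QuotientGroup.induction_on with
  | H x =>
    rw [smul_mk_eq_iff] at h ⊢
    exact (hu.exists_of_conj_mem h).1 v hv

lemma map_conj_parabolic {I I' : Set B} {p : W}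
    (h : (fun x => p * x * p⁻¹) '' (cs.simple '' I) = cs.simple '' I') :
    (cs.parabolic I).map (MulAut.conj p).toMonoidHom = cs.parabolic I' := by
  rw [parabolic, MonoidHom.map_closure, parabolic, ← h]
  rfl

/-- After conjugation, both elements fix exactly the cosets fixed by the whole of `W_I'`. -/
lemma inducedTrivial_eq_of_conj [Finite W] {I I' : Set B} {u v : W}
    (h : cs.conjSetoid.r I I') (hu : cs.IsElementOfType I u) (hv : cs.IsElementOfType I' v)
    (J : Set B) : (cs.inducedTrivial J : W → ℂ) u = (cs.inducedTrivial J : W → ℂ) v := by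
  obtain ⟨u', hu', huu⟩ := hu.exists_isCuspidal
  obtain ⟨v', hv', hvv⟩ := hv.exists_isCuspidal
  obtain ⟨p, hp⟩ := h
  rw [classFunctions_eq_of_isConj _ hvv, classFunctions_eq_of_isConj _
    (huu.trans (isConj_iff.mpr ⟨p, rfl⟩)), inducedTrivial_apply, inducedTrivial_apply]
  congr 1
  refine Nat.card_congr (Equiv.subtypeEquivRight fun c => ?_)
  have e : ∀ x : W, (p * x * p⁻¹) • c = c ↔ x • (p⁻¹ • c) = p⁻¹ • c := fun x => by
    rw [mul_smul, mul_smul, ← eq_inv_smul_iff]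
  rw [e, hu'.smul_eq_iff, hv'.smul_eq_iff, ← cs.map_conj_parabolic hp]
  simp [← e]

lemma inducedTrivial_ne_zero [Finite W] {I J : Set B} {w : W} (h : cs.conjSetoid.r I J)
    (hw : cs.IsElementOfType I w) : (cs.inducedTrivial J : W → ℂ) w ≠ 0 := by
  obtain ⟨u, hu, hwu⟩ := hw.exists_isCuspidal
  obtain ⟨p, hp⟩ := h
  rw [classFunctions_eq_of_isConj _ (hwu.trans (isConj_iff.mpr ⟨p, rfl⟩)),
    inducedTrivial_apply, Nat.cast_ne_zero]
  have : Nonempty {c : W ⧸ cs.parabolic J // (p * u * p⁻¹) • c = c} :=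
    ⟨((1 : W) : W ⧸ cs.parabolic J), by
      rw [smul_mk_eq_iff, ← cs.map_conj_parabolic hp]
      simpa using hu.1⟩
  exact Nat.card_pos.ne'

lemma exists_conj_subset_of_inducedTrivial_ne_zero [Finite W] {I J : Set B} {w : W}
    (hw : cs.IsElementOfType I w) (h : (cs.inducedTrivial J : W → ℂ) w ≠ 0) :
    ∃ d : W, (fun x => d * x * d⁻¹) '' (cs.simple '' I) ⊆ cs.simple '' J := by
  obtain ⟨u, hu, hwu⟩ := hw.exists_isCuspidal
  rw [classFunctions_eq_of_isConj _ hwu, inducedTrivial_apply, Nat.cast_ne_zero] at h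
  obtain ⟨⟨c, hc⟩⟩ := (Nat.card_ne_zero.mp h).1
  induction c using QuotientGroup.induction_on with
  | H x =>
    rw [smul_mk_eq_iff] at hc
    obtain ⟨-, d, hd⟩ := hu.exists_of_conj_mem hc
    refine ⟨d⁻¹, ?_⟩
    rintro _ ⟨_, ⟨i, hi, rfl⟩, rfl⟩
    obtain ⟨j, hj, hij⟩ := hd i hi
    exact ⟨j, hj, by simp [mul_assoc, hij]⟩

lemma ncard_image_conj_simple (I : Set B) (d : W) :
    ((fun x => d * x * d⁻¹) '' (cs.simple '' I)).ncard = I.ncard := by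
  rw [Set.ncard_image_of_injective _ fun x y h => by simpa using h,
    Set.ncard_image_of_injective _ cs.simple_injective]

/-- Triangularity by rank: a conjugate of `I` lies inside `J`, and equal cardinality makes the
inclusion an equality. -/
lemma ncard_le_of_inducedTrivial_ne_zero [Finite W] {I J : Set B} {w : W}
    (hw : cs.IsElementOfType I w) (h : (cs.inducedTrivial J : W → ℂ) w ≠ 0) :
    I.ncard ≤ J.ncard ∧ (I.ncard = J.ncard → cs.conjSetoid.r I J) := by
  have : Finite B := Finite.of_injective _ cs.simple_injective
  obtain ⟨d, hd⟩ := cs.exists_conj_subset_of_inducedTrivial_ne_zero hw h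
  rw [← cs.ncard_image_conj_simple I d, ← Set.ncard_image_of_injective J cs.simple_injective]
  exact ⟨Set.ncard_le_ncard hd, fun he => ⟨d, Set.eq_of_subset_of_ncard_le hd he.ge⟩⟩

/-! ### The image of the Solomon homomorphism -/

lemma solomonImage_eq_span [Finite W] :
    cs.solomonImage = Submodule.span ℚ (Set.range cs.inducedTrivial) :=
  Module.Basis.constr_range _ _

lemma inducedTrivial_mem_solomonImage [Finite W] (J : Set B) :
    cs.inducedTrivial J ∈ cs.solomonImage := by
  rw [solomonImage_eq_span]
  exact Submodule.subset_span ⟨J, rfl⟩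

/-- The rational-valued class functions that are constant on the `λ`-sets. -/
def typeConstant : Submodule ℚ (classFunctions W) where
  carrier := {f | (∀ w : W, ∃ q : ℚ, (f : W → ℂ) w = (q : ℂ)) ∧
    ∀ l : cs.CoxeterClass, ∀ u ∈ cs.coxeterTypeSet l, ∀ v ∈ cs.coxeterTypeSet l,
      (f : W → ℂ) u = (f : W → ℂ) v}
  add_mem' := by
    rintro f g ⟨hf, hf'⟩ ⟨hg, hg'⟩
    refine ⟨fun w => ?_, fun l u hu v hv => ?_⟩
    · obtain ⟨a, ha⟩ := hf w
      obtain ⟨b, hb⟩ := hg w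
      exact ⟨a + b, by simp [ha, hb]⟩
    · simp [hf' l u hu v hv, hg' l u hu v hv]
  zero_mem' := ⟨fun w => ⟨0, by simp⟩, fun l u hu v hv => rfl⟩
  smul_mem' := by
    rintro c f ⟨hf, hf'⟩
    refine ⟨fun w => ?_, fun l u hu v hv => ?_⟩
    · obtain ⟨a, ha⟩ := hf w
      exact ⟨c * a, by simp [ha, Rat.smul_def]⟩
    · simp [hf' l u hu v hv]

lemma solomonImage_le_typeConstant [Finite W] : cs.solomonImage ≤ cs.typeConstant := by
  rw [solomonImage_eq_span, Submodule.span_le]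
  rintro _ ⟨J, rfl⟩
  refine ⟨fun w => ⟨_, (cs.inducedTrivial_apply J w).trans (Rat.cast_natCast _).symm⟩, ?_⟩
  rintro l u ⟨I, rfl, hu⟩ v ⟨I', hI', hv⟩
  exact cs.inducedTrivial_eq_of_conj (cs.conjSetoid.iseqv.symm (Quotient.exact hI')) hu hv J

/-- Both functions are rational constants on the `λ`-set, and the induced character is nonzero
there; `q` is their ratio. -/
lemma exists_rat_mul_inducedTrivial [Finite W] {f : classFunctions W}
    (hf : f ∈ cs.typeConstant) (l : cs.CoxeterClass) (J : Set B)
    (hJ : Quotient.mk cs.conjSetoid J = l) :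
    ∃ q : ℚ, ∀ w ∈ cs.coxeterTypeSet l,
      (f : W → ℂ) w = q * (cs.inducedTrivial J : W → ℂ) w := by
  obtain h | ⟨v, hv⟩ := (cs.coxeterTypeSet l).eq_empty_or_nonempty
  · exact ⟨0, by simp [h]⟩
  have hi := cs.solomonImage_le_typeConstant (cs.inducedTrivial_mem_solomonImage J)
  obtain ⟨a, ha⟩ := hf.1 v
  obtain ⟨b, hb⟩ := hi.1 v
  have hb0 : (cs.inducedTrivial J : W → ℂ) v ≠ 0 := by
    obtain ⟨I, hI, hv⟩ := hv
    exact cs.inducedTrivial_ne_zero (Quotient.exact (hI.trans hJ.symm)) hv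
  refine ⟨a / b, fun w hw => ?_⟩
  rw [hf.2 l w hw v hv, hi.2 l w hw v hv, ha, Rat.cast_div, ← hb, div_mul_cancel₀ _ hb0]

lemma mem_solomonImage_of_vanishing [Finite W] (n : ℕ) {f : classFunctions W}
    (hf : f ∈ cs.typeConstant)
    (hn : ∀ (I : Set B) (w : W), n ≤ I.ncard → cs.IsElementOfType I w → (f : W → ℂ) w = 0) :
    f ∈ cs.solomonImage := by
  classical
  induction n generalizing f with
  | zero =>
    have : f = 0 := by
      ext w
      obtain ⟨I, hI⟩ := cs.exists_isElementOfType w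
      exact hn I w (Nat.zero_le _) hI
    rw [this]
    exact zero_mem _
  | succ n ih =>
    have : Finite B := Finite.of_injective _ cs.simple_injective
    have : Finite cs.CoxeterClass := inferInstanceAs (Finite (Quotient cs.conjSetoid))
    have := Fintype.ofFinite cs.CoxeterClass
    let rep : cs.CoxeterClass → Set B := Quotient.out
    have hrep : ∀ l, Quotient.mk cs.conjSetoid (rep l) = l := Quotient.out_eq
    choose q hq using fun l => cs.exists_rat_mul_inducedTrivial hf l (rep l) (hrep l)
    -- `g` agrees with `f` on elements of rank `n` and, by triangularity, vanishes on those of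
    -- larger rank, so `f - g` vanishes from rank `n` on.
    let g : classFunctions W :=
      ∑ l with (rep l).ncard = n, q l • cs.inducedTrivial (rep l)
    have hg : g ∈ cs.solomonImage := Submodule.sum_mem _ fun l _ =>
      Submodule.smul_mem _ _ (cs.inducedTrivial_mem_solomonImage _)
    have hgw : ∀ w, (g : W → ℂ) w = ∑ l with (rep l).ncard = n,
        q l * (cs.inducedTrivial (rep l) : W → ℂ) w := fun w => by
      simp [g, Rat.smul_def]
    have key : f - g ∈ cs.solomonImage := by
      refine ih (sub_mem hf (cs.solomonImage_le_typeConstant hg)) fun I w hI hw => ?_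
      change (f : W → ℂ) w - (g : W → ℂ) w = 0
      rw [hgw, sub_eq_zero]
      obtain ⟨k, hk⟩ : ∃ k : cs.CoxeterClass, Quotient.mk cs.conjSetoid I = k := ⟨_, rfl⟩
      have hz : ∀ l, (rep l).ncard = n → (cs.inducedTrivial (rep l) : W → ℂ) w ≠ 0 →
          I.ncard = n ∧ l = k := fun l hl h0 => by
        obtain ⟨h1, h2⟩ := cs.ncard_le_of_inducedTrivial_ne_zero hw h0
        have h3 : I.ncard = n := by omega
        exact ⟨h3, (hrep l).symm.trans ((Quotient.sound (h2 (h3.trans hl.symm))).symm.trans hk)⟩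
      have hfw := hq k w ⟨I, hk, hw⟩
      obtain hlt | heq := hI.lt_or_eq
      · rw [hn I w hlt hw, Finset.sum_eq_zero]
        intro l hl
        by_contra hne
        exact hlt.ne' (hz l (Finset.mem_filter.mp hl).2 (right_ne_zero_of_mul hne)).1
      · rw [hfw, Finset.sum_eq_single k]
        · intro l hl hne
          by_contra h0
          exact hne (hz l (Finset.mem_filter.mp hl).2 (right_ne_zero_of_mul h0)).2
        · intro hmem
          by_contra
          refine hmem (Finset.mem_filter.mpr ⟨Finset.mem_univ _, ?_⟩)
          obtain ⟨p, hp⟩ := Quotient.exact ((hrep k).trans hk.symm)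
          rw [← cs.ncard_image_conj_simple _ p, hp,
            Set.ncard_image_of_injective _ cs.simple_injective, heq]
    simpa using add_mem key hg

lemma solomonImage_eq_typeConstant [Finite W] : cs.solomonImage = cs.typeConstant := by
  refine le_antisymm cs.solomonImage_le_typeConstant fun f hf => ?_
  have : Finite B := Finite.of_injective _ cs.simple_injective
  -- No subset has `Nat.card B + 1` elements, so the vanishing hypothesis is vacuous.
  refine cs.mem_solomonImage_of_vanishing (Nat.card B + 1) hf fun I w hI _ => ?_
  have := Set.ncard_le_card I
  omega

end CoxeterSystem

theorem mainTheorem11 {B W : Type*} [Group W] [Finite W] {M : CoxeterMatrix B}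
    (cs : CoxeterSystem M W) (f : CoxeterSystem.classFunctions W) :
    f ∈ cs.solomonImage ↔
      (∀ w : W, ∃ q : ℚ, (f : W → ℂ) w = (q : ℂ)) ∧
      (∀ l : cs.CoxeterClass, ∀ u ∈ cs.coxeterTypeSet l, ∀ v ∈ cs.coxeterTypeSet l,
        (f : W → ℂ) u = (f : W → ℂ) v) := by
  rw [cs.solomonImage_eq_typeConstant]
  rfl
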